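/- Conventions. A semiring has $0$ and $1$, commutative addition, and $0$ is absorbing; a semifield is a commutative semiring $F$ in which $F\setminus\{0\}$ is a group under multiplication. All $F$-algebras are associative and unital. A right semimodule over a semiring $S$ is called *finitely generated strongly projective* if it is isomorphic to a direct summand of a free right $S$-semimodule $S^n$ for some natural number $n$, i.e. if $P\oplus Q\cong S^n$ for some right $S$-semimodule $Q$. Let $\mathcal{SV}(S)$ denote the commutative monoid of isomorphism classes $\overline{P}$ of finitely generated strongly projective right $S$-semimodules $P$, with $\overline{P}+\overline{Q}=\overline{P\oplus Q}$ and zero element $\overline{0}$, and let $\overline{S}\in\mathcal{SV}(S)$ be the class of the right semimodule $S$. An $F$-algebra is *matricial* if it is isomorphic to $M_{n_1}(F)\times\cdots\times M_{n_r}(F)$ for some $r \ge 0$ and positive integers $n_1,\dots,n_r$, and *ultramatricial* if it is isomorphic to the direct limit, in the category of unital $F$-algebras, of a sequence $S_1\to S_2\to\cdots$ of matricial $F$-algebras. Theorem 5.10. Let $S$ and $T$ be ultramatricial algebras over a semifield $F$. Then $(\mathcal{SV}(S),\overline{S})\cong(\mathcal{SV}(T),\overline{T})$, i.e. there is an isomorphism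 of monoids $f\colon\mathcal{SV}(S)\to\mathcal{SV}(T)$ with $f(\overline{S})=\overline{T}$, if and only if $S\cong T$ as $F$-algebras. -/

import Mathlib

/-!
Conventions. A semiring is a `Semiring`; a semifield is a `Semifield`; a unital `F`-algebra is a
`Semiring` `A` with `Algebra F A`. A right `S`-semimodule is an additive commutative monoid with a
`Module` structure over the opposite semiring `Sᵐᵒᵖ`; in particular `S` itself is one, by right
multiplication.
-/

universe u v w

/-- An `F`-algebra is matricial if it is isomorphic to a finite product of matrix algebras
`M_{n_1}(F) × ⋯ × M_{n_r}(F)` with positive integers `n_1, …, n_r`. -/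
def IsMatricial (F : Type u) [Semifield F] (A : Type v) [Semiring A] [Algebra F A] : Prop :=
  ∃ (r : ℕ) (n : Fin r → ℕ), (∀ i, 0 < n i) ∧
    Nonempty (A ≃ₐ[F] ((i : Fin r) → Matrix (Fin (n i)) (Fin (n i)) F))

/-- An `F`-algebra is ultramatricial if it is isomorphic to the direct limit, as a unital
`F`-algebra, of a sequence of matricial `F`-algebras. (Matricial algebras have isomorphic copies in
the universe of `F`, so taking the sequence there is no restriction.) -/
def IsUltramatricial (F : Type u) [Semifield F] (A : Type v) [Semiring A] [Algebra F A] : Prop :=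
  ∃ (B : ℕ → Type u) (_ : ∀ i, Semiring (B i)) (_ : ∀ i, Algebra F (B i))
    (f : ∀ i j : ℕ, i ≤ j → B i →ₐ[F] B j) (_ : DirectedSystem B (fun i j h => f i j h)),
    (∀ i, IsMatricial F (B i)) ∧ Nonempty (A ≃ₐ[F] DirectLimit B f)

/-- A right `S`-semimodule `P` is finitely generated strongly projective if it is (isomorphic to) a
direct summand of a free right semimodule `S^n` of finite rank. -/
def IsFGStronglyProjective (S : Type v) [Semiring S]
    (P : Type w) [AddCommMonoid P] [Module Sᵐᵒᵖ P] : Prop :=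
  ∃ (n : ℕ) (Q : Type v) (_ : AddCommMonoid Q) (_ : Module Sᵐᵒᵖ Q),
    Nonempty ((P × Q) ≃ₗ[Sᵐᵒᵖ] (Fin n → S))

theorem IsFGStronglyProjective.self (S : Type v) [Semiring S] : IsFGStronglyProjective S S :=
  ⟨1, PUnit, inferInstance, inferInstance,
    ⟨LinearEquiv.prodUnique.trans (LinearEquiv.funUnique (Fin 1) Sᵐᵒᵖ S).symm⟩⟩

theorem IsFGStronglyProjective.zero (S : Type v) [Semiring S] :
    IsFGStronglyProjective S (PUnit : Type w) :=
  ⟨0, PUnit, inferInstance, inferInstance, ⟨0, 0, fun _ => rfl, fun _ => Subsingleton.elim _ _⟩⟩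

theorem IsFGStronglyProjective.prod {S : Type v} [Semiring S]
    {P P' : Type w} [AddCommMonoid P] [Module Sᵐᵒᵖ P] [AddCommMonoid P'] [Module Sᵐᵒᵖ P']
    (h : IsFGStronglyProjective S P) (h' : IsFGStronglyProjective S P') :
    IsFGStronglyProjective S (P × P') := by
  obtain ⟨n, Q, _, _, ⟨e⟩⟩ := h
  obtain ⟨n', Q', _, _, ⟨e'⟩⟩ := h'
  exact ⟨n + n', Q × Q', inferInstance, inferInstance,
    ⟨(LinearEquiv.prodProdProdComm Sᵐᵒᵖ P P' Q Q').trans <|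
      (e.prodCongr e').trans <|
      (LinearEquiv.sumArrowLequivProdArrow (Fin n) (Fin n') Sᵐᵒᵖ S).symm.trans <|
      LinearEquiv.funCongrLeft Sᵐᵒᵖ S finSumFinEquiv.symm⟩⟩

/-- The finitely generated strongly projective right `S`-semimodules. -/
structure FGStronglyProjective (S : Type v) [Semiring S] : Type (v + 1) where
  carrier : Type v
  [addCommMonoid : AddCommMonoid carrier]
  [module : Module Sᵐᵒᵖ carrier]
  stronglyProjective : IsFGStronglyProjective S carrier

namespace FGStronglyProjective

attribute [instance] addCommMonoid module

/-- Two semimodules are equivalent if they are isomorphic as right `S`-semimodules. -/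
instance isoSetoid (S : Type v) [Semiring S] : Setoid (FGStronglyProjective S) where
  r P Q := Nonempty (P.carrier ≃ₗ[Sᵐᵒᵖ] Q.carrier)
  iseqv :=
    ⟨fun _ => ⟨LinearEquiv.refl _ _⟩, fun ⟨e⟩ => ⟨e.symm⟩, fun ⟨e⟩ ⟨e'⟩ => ⟨e.trans e'⟩⟩

end FGStronglyProjective

/-- `SV S`: the isomorphism classes of finitely generated strongly projective right
`S`-semimodules. -/
def SV (S : Type v) [Semiring S] : Type (v + 1) :=
  Quotient (FGStronglyProjective.isoSetoid S)

namespace SV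

/-- The isomorphism class of a finitely generated strongly projective right `S`-semimodule. -/
def mk (S : Type v) [Semiring S] (P : Type v) [AddCommMonoid P] [Module Sᵐᵒᵖ P]
    (h : IsFGStronglyProjective S P) : SV S :=
  Quotient.mk (FGStronglyProjective.isoSetoid S) ⟨P, h⟩

/-- The isomorphism class of the right `S`-semimodule `S`. -/
def unit (S : Type v) [Semiring S] : SV S :=
  mk S S (IsFGStronglyProjective.self S)

/-- The zero element is the class `[0]` of the zero semimodule. -/
instance instZero (S : Type v) [Semiring S] : Zero (SV S) :=
  ⟨mk S PUnit (IsFGStronglyProjective.zero S)⟩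

/-- The addition is `[P] + [Q] = [P ⊕ Q]`. -/
instance instAdd (S : Type v) [Semiring S] : Add (SV S) :=
  ⟨Quotient.map₂
    (fun P Q => ⟨P.carrier × Q.carrier, P.stronglyProjective.prod Q.stronglyProjective⟩)
    (fun _ _ ⟨e⟩ _ _ ⟨e'⟩ => ⟨e.prodCongr e'⟩)⟩

instance instAddCommMonoid (S : Type v) [Semiring S] : AddCommMonoid (SV S) where
  add_assoc := by
    rintro ⟨P⟩ ⟨Q⟩ ⟨R⟩
    exact Quotient.sound ⟨LinearEquiv.prodAssoc Sᵐᵒᵖ P.carrier Q.carrier R.carrier⟩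
  zero_add := by
    rintro ⟨P⟩
    exact Quotient.sound ⟨LinearEquiv.uniqueProd⟩
  add_zero := by
    rintro ⟨P⟩
    exact Quotient.sound ⟨LinearEquiv.prodUnique⟩
  add_comm := by
    rintro ⟨P⟩ ⟨Q⟩
    exact Quotient.sound ⟨LinearEquiv.prodComm Sᵐᵒᵖ P.carrier Q.carrier⟩
  nsmul := nsmulRec

end SV

/-! This is Elliott's classification argument, carried out without subtraction. Since `1 - e` need
not exist, idempotents are replaced by complemented ones: these are the `e` for which `e R` is
visibly a direct summand of `R`. Two facts translate `SV R` into elements of `R`: `e R ≅ f R`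
exactly when `e` and `f` are Murray–von Neumann equivalent (`nonempty_corner_equiv_iff`), and every
way of writing `[R]` as a finite sum of classes comes from a complete orthogonal family of
idempotents (`exists_idempotents_of_sum_eq_unit`).

A homomorphism from a product of matrix algebras is the same as a complete system of matrix units.
Hence for such a source `B`, a unit-preserving isomorphism `f` of the monoids can be lifted: each `β
: B → S` has a `φ : B → T` inducing `f ∘ β_*` (`exists_realizes`), and homomorphisms inducing the
same classes are conjugate by a unit (`exists_conj_of_cls_eq`). No cancellation in `SV` is needed,
because complete families of idempotents are compared piece by piece. To control all complemented
idempotents of `B`, each is shown to be equivalent to a sum of diagonal matrix units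
(`exists_mvn_diagonal`).

A homomorphism from `B` into a direct limit involves finitely many elements and relations, so it
factors through a finite stage. Alternating lifts of `f` and `f⁻¹`, and correcting each by a
conjugation so that triangles commute exactly, intertwines the two sequences; their limits are then
isomorphic. Conversely, an algebra isomorphism transports semimodules. -/

/-! ### Complemented idempotents and Murray–von Neumann equivalence -/

/-- An element `e` that has a complement `e'`: `e + e' = 1` and `e e' = e' e = 0`. -/
def IsComplIdem {R : Type*} [Semiring R] (e : R) : Prop :=
  ∃ e', e + e' = 1 ∧ e * e' = 0 ∧ e' * e = 0

/-- Murray–von Neumann equivalence. -/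
def MvN {R : Type*} [Semiring R] (e f : R) : Prop :=
  ∃ x y, x * y = e ∧ y * x = f

theorem IsComplIdem.mul_self {R : Type*} [Semiring R] {e : R} (h : IsComplIdem e) :
    e * e = e := by
  obtain ⟨e', h1, h2, -⟩ := h
  calc e * e = e * (e + e') := by rw [mul_add, h2, add_zero]
    _ = e := by rw [h1, mul_one]

theorem IsComplIdem.map {R R' : Type*} [Semiring R] [Semiring R'] {e : R} (h : IsComplIdem e)
    {G : Type*} [FunLike G R R'] [RingHomClass G R R'] (φ : G) : IsComplIdem (φ e) := by
  obtain ⟨e', h1, h2, h3⟩ := h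
  exact ⟨φ e', by rw [← map_add, h1, map_one], by rw [← map_mul, h2, map_zero],
    by rw [← map_mul, h3, map_zero]⟩

theorem MvN.map {R R' : Type*} [Semiring R] [Semiring R'] {e f : R} (h : MvN e f)
    {G : Type*} [FunLike G R R'] [RingHomClass G R R'] (φ : G) : MvN (φ e) (φ f) := by
  obtain ⟨x, y, h1, h2⟩ := h
  exact ⟨φ x, φ y, by rw [← map_mul, h1], by rw [← map_mul, h2]⟩

/-- The partial isometries implementing an equivalence of idempotents can be taken in the
corresponding corners. -/
theorem MvN.exists_corner {R : Type*} [Semiring R] {e f : R} (h : MvN e f)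
    (he : e * e = e) (hf : f * f = f) :
    ∃ x y, x * y = e ∧ y * x = f ∧ e * x = x ∧ x * f = x ∧ f * y = y ∧ y * e = y := by
  obtain ⟨x, y, rfl, rfl⟩ := h
  -- With `e = x * y` and `f = y * x`, these are the compressions `e * x * f` and `f * y * e`.
  refine ⟨x * y * x, y * x * y, ?_, ?_, ?_, ?_, ?_, ?_⟩
  · calc x * y * x * (y * x * y) = (x * y * (x * y)) * (x * y) := by simp only [mul_assoc]
      _ = x * y := by rw [he, he]
  · calc y * x * y * (x * y * x) = (y * x * (y * x)) * (y * x) := by simp only [mul_assoc]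
      _ = y * x := by rw [hf, hf]
  · rw [← mul_assoc, he]
  · rw [mul_assoc x y x, mul_assoc, hf]
  · rw [← mul_assoc, hf]
  · rw [mul_assoc y x y, mul_assoc, he]

/-- A complete family of orthogonal idempotents yields a complemented idempotent for each set of
indices. -/
theorem isComplIdem_sum {R K : Type*} [Semiring R] [Fintype K] [DecidableEq K] {g : K → R}
    (hg : ∀ k l, k ≠ l → g k * g l = 0) (h1 : ∑ k, g k = 1) (s : Finset K) :
    IsComplIdem (∑ k ∈ s, g k) := by
  refine ⟨∑ k ∈ sᶜ, g k, by rw [Finset.sum_add_sum_compl, h1], ?_, ?_⟩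
  · rw [Finset.sum_mul_sum]
    refine Finset.sum_eq_zero fun i hi => Finset.sum_eq_zero fun j hj => hg _ _ ?_
    rintro rfl
    exact Finset.mem_compl.1 hj hi
  · rw [Finset.sum_mul_sum]
    refine Finset.sum_eq_zero fun i hi => Finset.sum_eq_zero fun j hj => hg _ _ ?_
    rintro rfl
    exact Finset.mem_compl.1 hi hj

/-! ### The class in `SV R` of a complemented idempotent -/

/-- The right ideal `e R`, described as the set of fixed points of left multiplication by `e`. -/
def corner {R : Type v} [Semiring R] (e : R) : Submodule Rᵐᵒᵖ R where
  carrier := {z | e * z = z}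
  add_mem' {a b} ha hb := by
    simp only [Set.mem_ofPred_eq] at *
    rw [mul_add, ha, hb]
  zero_mem' := by simp
  smul_mem' c x hx := by
    simp only [Set.mem_ofPred_eq, MulOpposite.smul_eq_mul_unop] at *
    rw [← mul_assoc, hx]

theorem mem_corner {R : Type v} [Semiring R] {e z : R} : z ∈ corner e ↔ e * z = z := Iff.rfl

/-- `e R ⊕ f R ≅ (e + f) R` for orthogonal idempotents. -/
def cornerAddEquiv {R : Type v} [Semiring R] {e f : R} (he : e * e = e) (hf : f * f = f)
    (hef : e * f = 0) (hfe : f * e = 0) : (corner e × corner f) ≃ₗ[Rᵐᵒᵖ] corner (e + f) where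
  toFun z := ⟨z.1 + z.2, by
    have h1 : f * (z.1 : R) = 0 := by
      rw [← mem_corner.1 z.1.2, ← mul_assoc, hfe, zero_mul]
    have h2 : e * (z.2 : R) = 0 := by
      rw [← mem_corner.1 z.2.2, ← mul_assoc, hef, zero_mul]
    rw [mem_corner, add_mul, mul_add, mul_add, h1, h2, mem_corner.1 z.1.2, mem_corner.1 z.2.2,
      add_zero, zero_add]⟩
  map_add' x y := by ext; simp [add_add_add_comm]
  map_smul' c x := by ext; simp
  invFun z := (⟨e * z, by rw [mem_corner, ← mul_assoc, he]⟩,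
    ⟨f * z, by rw [mem_corner, ← mul_assoc, hf]⟩)
  left_inv z := by
    have h1 : f * (z.1 : R) = 0 := by
      rw [← mem_corner.1 z.1.2, ← mul_assoc, hfe, zero_mul]
    have h2 : e * (z.2 : R) = 0 := by
      rw [← mem_corner.1 z.2.2, ← mul_assoc, hef, zero_mul]
    ext
    · simp [mul_add, h2, mem_corner.1 z.1.2]
    · simp [mul_add, h1, mem_corner.1 z.2.2]
  right_inv z := by
    ext
    simp only [← add_mul]
    exact z.2

/-- `1 R = R`. -/
def cornerOneEquiv (R : Type v) [Semiring R] : corner (1 : R) ≃ₗ[Rᵐᵒᵖ] R where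
  toFun z := z
  map_add' _ _ := rfl
  map_smul' _ _ := rfl
  invFun z := ⟨z, one_mul z⟩
  left_inv _ := rfl
  right_inv _ := rfl

theorem IsComplIdem.isFGStronglyProjective {R : Type v} [Semiring R] {e : R}
    (h : IsComplIdem e) : IsFGStronglyProjective R (corner e) := by
  have he := h.mul_self
  obtain ⟨e', h1, h2, h3⟩ := h
  have he' : e' * e' = e' := IsComplIdem.mul_self ⟨e, by rw [add_comm, h1], h3, h2⟩
  refine ⟨1, corner e', inferInstance, inferInstance, ⟨?_⟩⟩
  have E := cornerAddEquiv he he' h2 h3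
  rw [h1] at E
  exact E.trans ((cornerOneEquiv R).trans (LinearEquiv.funUnique (Fin 1) Rᵐᵒᵖ R).symm)

open Classical in
/-- The class of `e R` in `SV R`, for `e` a complemented idempotent (and `0` otherwise). -/
noncomputable def cls {R : Type v} [Semiring R] (e : R) : SV R :=
  if h : IsComplIdem e then SV.mk R (corner e) h.isFGStronglyProjective else 0

theorem cls_eq {R : Type v} [Semiring R] {e : R} (h : IsComplIdem e) :
    cls e = SV.mk R (corner e) h.isFGStronglyProjective := dif_pos h

theorem SV.mk_eq_mk {R : Type v} [Semiring R] {P Q : Type v} [AddCommMonoid P] [Module Rᵐᵒᵖ P]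
    [AddCommMonoid Q] [Module Rᵐᵒᵖ Q] {hP : IsFGStronglyProjective R P}
    {hQ : IsFGStronglyProjective R Q} :
    SV.mk R P hP = SV.mk R Q hQ ↔ Nonempty (P ≃ₗ[Rᵐᵒᵖ] Q) :=
  ⟨fun h => Quotient.exact h, fun h => Quotient.sound h⟩

theorem isComplIdem_one {R : Type v} [Semiring R] : IsComplIdem (1 : R) :=
  ⟨0, by simp⟩

theorem isComplIdem_zero {R : Type v} [Semiring R] : IsComplIdem (0 : R) :=
  ⟨1, by simp⟩

theorem cls_one (R : Type v) [Semiring R] : cls (1 : R) = SV.unit R := by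
  rw [cls_eq isComplIdem_one]
  exact SV.mk_eq_mk.2 ⟨cornerOneEquiv R⟩

theorem cls_zero (R : Type v) [Semiring R] : cls (0 : R) = 0 := by
  rw [cls_eq isComplIdem_zero]
  refine SV.mk_eq_mk.2 ⟨?_⟩
  have : Subsingleton (corner (0 : R)) :=
    ⟨fun a b => Subtype.ext (by rw [← mem_corner.1 a.2, ← mem_corner.1 b.2, zero_mul, zero_mul])⟩
  exact ⟨0, 0, fun _ => Subsingleton.elim _ _, fun _ => rfl⟩

theorem cls_add {R : Type v} [Semiring R] {e f : R} (he : IsComplIdem e) (hf : IsComplIdem f)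
    (hs : IsComplIdem (e + f)) (hef : e * f = 0) (hfe : f * e = 0) :
    cls (e + f) = cls e + cls f := by
  rw [cls_eq he, cls_eq hf, cls_eq hs]
  exact SV.mk_eq_mk.2 ⟨(cornerAddEquiv he.mul_self hf.mul_self hef hfe).symm⟩

theorem cls_sum {R : Type v} {K : Type*} [Semiring R] [Fintype K] [DecidableEq K] {g : K → R}
    (hg : ∀ k l, k ≠ l → g k * g l = 0) (h1 : ∑ k, g k = 1) (s : Finset K) :
    cls (∑ k ∈ s, g k) = ∑ k ∈ s, cls (g k) := by
  induction s using Finset.induction_on with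
  | empty => simp [cls_zero]
  | insert a s ha ih =>
    have hk : IsComplIdem (g a) := by simpa using isComplIdem_sum hg h1 {a}
    have hs := isComplIdem_sum hg h1 (insert a s)
    rw [Finset.sum_insert ha] at hs
    rw [Finset.sum_insert ha, Finset.sum_insert ha, ← ih]
    refine cls_add hk (isComplIdem_sum hg h1 s) hs ?_ ?_
    · rw [Finset.mul_sum]
      exact Finset.sum_eq_zero fun i hi => hg _ _ (by rintro rfl; exact ha hi)
    · rw [Finset.sum_mul]
      exact Finset.sum_eq_zero fun i hi => hg _ _ (by rintro rfl; exact ha hi)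

/-- A right-linear map out of `e R` is left multiplication by the image of `e`. The images of the
two generators under an isomorphism and its inverse are therefore the required `y` and `x`. -/
theorem nonempty_corner_equiv_iff {R : Type v} [Semiring R] {e f : R} (he : e * e = e)
    (hf : f * f = f) : Nonempty (corner e ≃ₗ[Rᵐᵒᵖ] corner f) ↔ MvN e f := by
  constructor
  · rintro ⟨θ⟩
    have key : ∀ (a b : R) (ha : a * a = a) (η : corner a →ₗ[Rᵐᵒᵖ] corner b) (z : corner a),
        (η ⟨a, ha⟩ : R) * z = η z := by
      intro a b ha η z
      have : z = MulOpposite.op (z : R) • (⟨a, ha⟩ : corner a) := by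
        ext; exact (mem_corner.1 z.2).symm
      conv_rhs => rw [this, map_smul]
      rfl
    refine ⟨θ.symm ⟨f, hf⟩, θ ⟨e, he⟩, ?_, ?_⟩
    · have := key f e hf θ.symm.toLinearMap (θ ⟨e, he⟩)
      simpa using this
    · have := key e f he θ.toLinearMap (θ.symm ⟨f, hf⟩)
      simpa using this
  · intro h
    obtain ⟨x, y, h1, h2, hx, hx', hy, hy'⟩ := h.exists_corner he hf
    exact ⟨{
      toFun := fun z => ⟨y * z, by rw [mem_corner, ← mul_assoc, hy]⟩
      map_add' := fun a b => by ext; simp [mul_add]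
      map_smul' := fun c a => by ext; simp [mul_assoc]
      invFun := fun z => ⟨x * z, by rw [mem_corner, ← mul_assoc, hx]⟩
      left_inv := fun z => by
        ext
        change x * (y * (z : R)) = z
        rw [← mul_assoc, h1]; exact z.2
      right_inv := fun z => by
        ext
        change y * (x * (z : R)) = z
        rw [← mul_assoc, h2]; exact z.2 }⟩

theorem cls_eq_cls_iff {R : Type v} [Semiring R] {e f : R} (he : IsComplIdem e)
    (hf : IsComplIdem f) : cls e = cls f ↔ MvN e f := by
  rw [cls_eq he, cls_eq hf, SV.mk_eq_mk, nonempty_corner_equiv_iff he.mul_self hf.mul_self]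

/-! ### Decompositions of the unit class -/

/-- Addition in `SV` is defined by binary products; induction on the finite index type, one point at
a time, turns a finite sum into a single product over `K`. -/
theorem SV.sum_eq_mk_pi {R : Type v} [Semiring R] (K : Type) [Fintype K] :
    ∀ Q : K → FGStronglyProjective R,
      ∃ h : IsFGStronglyProjective R (∀ k, (Q k).carrier),
        ∑ k, SV.mk R (Q k).carrier (Q k).stronglyProjective = SV.mk R (∀ k, (Q k).carrier) h := by
  classical
  have transport : ∀ (A B : Type v) [AddCommMonoid A] [Module Rᵐᵒᵖ A] [AddCommMonoid B]
      [Module Rᵐᵒᵖ B] (_ : A ≃ₗ[Rᵐᵒᵖ] B) (hA : IsFGStronglyProjective R A),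
      ∃ hB : IsFGStronglyProjective R B, SV.mk R A hA = SV.mk R B hB := by
    intro A B _ _ _ _ e hA
    have hB : IsFGStronglyProjective R B := by
      obtain ⟨n, C, _, _, ⟨c⟩⟩ := hA
      exact ⟨n, C, _, _, ⟨(e.symm.prodCongr (LinearEquiv.refl _ _)).trans c⟩⟩
    exact ⟨hB, SV.mk_eq_mk.2 ⟨e⟩⟩
  refine Fintype.induction_empty_option (P := fun K _ => ∀ Q : K → FGStronglyProjective R,
      ∃ h : IsFGStronglyProjective R (∀ k, (Q k).carrier),
        ∑ k, SV.mk R (Q k).carrier (Q k).stronglyProjective = SV.mk R (∀ k, (Q k).carrier) h)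
    ?_ ?_ ?_ K
  · intro α β _ e ih Q
    let _ : Fintype α := Fintype.ofEquiv β e.symm
    obtain ⟨h, hh⟩ := ih (fun a => Q (e a))
    obtain ⟨h', hh'⟩ := transport _ (∀ k, (Q k).carrier)
      (LinearEquiv.piCongrLeft Rᵐᵒᵖ (fun k => (Q k).carrier) e) h
    refine ⟨h', ?_⟩
    rw [← hh', ← hh]
    exact (Equiv.sum_comp e
      (fun k => SV.mk R (Q k).carrier (Q k).stronglyProjective)).symm
  · intro Q
    obtain ⟨h, hh⟩ := transport PUnit (∀ k, (Q k).carrier)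
      ⟨0, 0, fun _ => rfl, fun _ => funext fun k => k.elim⟩ (IsFGStronglyProjective.zero R)
    exact ⟨h, by rw [← hh]; rfl⟩
  · intro α _ ih Q
    obtain ⟨h, hh⟩ := ih (fun a => Q (some a))
    obtain ⟨h', hh'⟩ := transport _ (∀ k, (Q k).carrier)
      (LinearEquiv.piOptionEquivProd Rᵐᵒᵖ (M := fun k => (Q k).carrier)).symm
      ((Q none).stronglyProjective.prod h)
    refine ⟨h', ?_⟩
    rw [← hh', Fintype.sum_option, hh]
    rfl

/-- If `[R]` is a finite sum of classes in `SV R`, these are the classes of a complete family of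
orthogonal idempotents. -/
theorem exists_idempotents_of_sum_eq_unit {R : Type v} [Semiring R] {K : Type} [Fintype K]
    [DecidableEq K] (p : K → SV R) (hp : ∑ k, p k = SV.unit R) :
    ∃ g : K → R, (∀ k l, k ≠ l → g k * g l = 0) ∧ ∑ k, g k = 1 ∧ ∀ k, cls (g k) = p k := by
  choose Q hQ using fun k => Quotient.exists_rep (p k)
  obtain ⟨h, hh⟩ := SV.sum_eq_mk_pi K Q
  have hQ' : ∀ k, SV.mk R (Q k).carrier (Q k).stronglyProjective = p k := hQ
  simp only [hQ', hp] at hh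
  obtain ⟨θ⟩ := SV.mk_eq_mk.1 hh
  have hθ : ∀ z k, θ z k = MulOpposite.op z • θ 1 k := by
    intro z k
    rw [← Pi.smul_apply, ← map_smul]
    simp
  -- `g k` is the component of `1` in the `k`-th summand; by right linearity of `θ`, left
  -- multiplication by `g k` is the projection onto that summand.
  set g : K → R := fun k => θ.symm (Pi.single k (θ 1 k)) with hgdef
  have hmul : ∀ k z, g k * z = θ.symm (Pi.single k (θ z k)) := by
    intro k z
    have : g k * z = MulOpposite.op z • g k := by simp
    rw [this, hgdef]
    simp only
    rw [← map_smul, ← Pi.single_smul, ← hθ]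
  have h0 : ∀ k l, k ≠ l → g k * g l = 0 := by
    intro k l hkl
    rw [hmul]
    simp [hgdef, Pi.single_eq_of_ne hkl]
  have h1 : ∑ k, g k = 1 := by
    rw [hgdef, ← map_sum, Finset.univ_sum_single, LinearEquiv.symm_apply_apply]
  refine ⟨g, h0, h1, fun k => ?_⟩
  have hc : IsComplIdem (g k) := by simpa using isComplIdem_sum h0 h1 {k}
  rw [cls_eq hc, ← hQ' k]
  refine SV.mk_eq_mk.2 ⟨{
    toFun := fun z => θ z k
    map_add' := fun a b => by simp
    map_smul' := fun c a => by rw [Submodule.coe_smul, map_smul]; rfl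
    invFun := fun q => ⟨θ.symm (Pi.single k q), by rw [mem_corner, hmul]; simp⟩
    left_inv := fun z => by
      ext
      change θ.symm (Pi.single k (θ (z : R) k)) = z
      rw [← hmul]; exact z.2
    right_inv := fun q => by simp }⟩

/-! ### Products of matrix algebras and matrix units -/

/-- The product of the matrix algebras `M_{n i}(F)`. -/
abbrev Blocks (F : Type u) {I : Type} (n : I → ℕ) : Type u :=
  ∀ i, Matrix (Fin (n i)) (Fin (n i)) F

/-- A complete system of matrix units in `R` of the shape of `Blocks F n`. -/
structure IsMatrixUnits {I : Type} [Fintype I] {n : I → ℕ} {R : Type v} [Semiring R]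
    (m : ∀ i, Fin (n i) → Fin (n i) → R) : Prop where
  mul_same : ∀ i j k l, m i j k * m i k l = m i j l
  mul_ne : ∀ i j k i' j' l, (⟨i, k⟩ : Σ i, Fin (n i)) ≠ ⟨i', j'⟩ → m i j k * m i' j' l = 0
  sum_diag : ∑ p : Σ i, Fin (n i), m p.1 p.2 p.2 = 1

theorem IsMatrixUnits.map {I : Type} [Fintype I] {n : I → ℕ} {R R' : Type*} [Semiring R] [Semiring R']
    {m : ∀ i, Fin (n i) → Fin (n i) → R} (hm : IsMatrixUnits m) {G : Type*} [FunLike G R R']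
    [RingHomClass G R R'] (φ : G) : IsMatrixUnits fun i j k => φ (m i j k) where
  mul_same i j k l := by rw [← map_mul, hm.mul_same]
  mul_ne i j k i' j' l h := by rw [← map_mul, hm.mul_ne _ _ _ _ _ _ h, map_zero]
  sum_diag := by rw [← map_sum, hm.sum_diag, map_one]

namespace Blocks

variable {F : Type u} [Semifield F] {I : Type} [Fintype I] [DecidableEq I] {n : I → ℕ}

/-- The standard matrix units of `Blocks F n`. -/
def munit (F : Type u) [Semifield F] {I : Type} [DecidableEq I] {n : I → ℕ}
    (i : I) (j k : Fin (n i)) : Blocks F n :=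
  Pi.single i (Matrix.single j k 1)

theorem eq_sum (A : Blocks F n) : A = ∑ i, ∑ j, ∑ k, A i j k • munit F i j k := by
  conv_lhs => rw [← Finset.univ_sum_single A]
  refine Finset.sum_congr rfl fun i _ => ?_
  conv_lhs => rw [Matrix.matrix_eq_sum_single (A i)]
  simp only [munit, ← Pi.single_smul, Matrix.smul_single, smul_eq_mul, mul_one]
  simp only [← LinearMap.coe_single (R := F) (φ := fun i => Matrix (Fin (n i)) (Fin (n i)) F),
    map_sum]

theorem induction {P : Blocks F n → Prop} (h0 : P 0) (hadd : ∀ a b, P a → P b → P (a + b))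
    (hsmul : ∀ (c : F) a, P a → P (c • a)) (hu : ∀ i j k, P (munit F i j k)) (A : Blocks F n) :
    P A := by
  rw [eq_sum A]
  exact Finset.sum_induction _ P hadd h0 fun i _ => Finset.sum_induction _ P hadd h0 fun j _ =>
    Finset.sum_induction _ P hadd h0 fun k _ => hsmul _ _ (hu i j k)

theorem isMatrixUnits_munit : IsMatrixUnits (munit F (n := n)) where
  mul_same i j k l := by simp [munit, ← Pi.single_mul]
  mul_ne i j k i' j' l h := by
    by_cases hi : i = i'
    · subst hi
      have : k ≠ j' := fun h' => h (by rw [h'])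
      simp [munit, ← Pi.single_mul, this]
    · ext x : 1
      by_cases hx : x = i
      · subst hx; simp [munit, Pi.single_eq_of_ne hi]
      · simp [munit, Pi.single_eq_of_ne hx]
  sum_diag := by
    rw [Fintype.sum_sigma]
    conv_rhs => rw [eq_sum (1 : Blocks F n)]
    refine Finset.sum_congr rfl fun i _ => Finset.sum_congr rfl fun j _ => ?_
    rw [Finset.sum_eq_single j]
    · simp
    · intro k _ hk; simp [Matrix.one_apply_ne' hk]
    · simp

theorem algHom_ext {R : Type v} [Semiring R] [Algebra F R] {φ ψ : Blocks F n →ₐ[F] R}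
    (h : ∀ i j k, φ (munit F i j k) = ψ (munit F i j k)) : φ = ψ := by
  ext A
  induction A using induction with
  | h0 => simp
  | hadd a b ha hb => rw [map_add, map_add, ha, hb]
  | hsmul c a ha => rw [map_smul, map_smul, ha]
  | hu i j k => exact h i j k

/-- A complete system of matrix units is the image of the standard one under an algebra
homomorphism. -/
theorem exists_algHom {R : Type v} [Semiring R] [Algebra F R]
    {m : ∀ i, Fin (n i) → Fin (n i) → R} (hm : IsMatrixUnits m) :
    ∃ φ : Blocks F n →ₐ[F] R, ∀ i j k, φ (munit F i j k) = m i j k := by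
  let L : Blocks F n →ₗ[F] R :=
    { toFun := fun A => ∑ i, ∑ j, ∑ k, A i j k • m i j k
      map_add' := fun A B => by simp [add_smul, Finset.sum_add_distrib]
      map_smul' := fun c A => by simp [mul_smul, Finset.smul_sum] }
  have hL : ∀ i j k, L (munit F i j k) = m i j k := by
    intro i j k
    change ∑ i', ∑ j', ∑ k', munit F i j k i' j' k' • m i' j' k' = _
    rw [Finset.sum_eq_single i, Finset.sum_eq_single j, Finset.sum_eq_single k]
    · simp [munit]
    · intro k' _ hk; simp [munit, hk.symm]
    · simp
    · intro j' _ hj; simp [munit, hj.symm]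
    · simp
    · intro i' _ hi; simp [munit, Pi.single_eq_of_ne hi]
    · simp
  have h1 : L 1 = 1 := by
    rw [← (isMatrixUnits_munit (F := F) (n := n)).sum_diag, map_sum]
    simp only [hL, hm.sum_diag]
  have hmul : ∀ A B, L (A * B) = L A * L B := by
    intro A B
    induction A using induction with
    | h0 => simp
    | hadd a b ha hb => rw [add_mul, map_add, map_add, ha, hb, add_mul]
    | hsmul c a ha => rw [smul_mul_assoc, map_smul, map_smul, ha, smul_mul_assoc]
    | hu i j k =>
      induction B using induction with
      | h0 => simp
      | hadd a b ha hb => rw [mul_add, map_add, map_add, ha, hb, mul_add]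
      | hsmul c a ha => rw [mul_smul_comm, map_smul, map_smul, ha, mul_smul_comm]
      | hu i' j' l =>
        rw [hL, hL]
        by_cases h : (⟨i, k⟩ : Σ i, Fin (n i)) = ⟨i', j'⟩
        · cases h
          rw [isMatrixUnits_munit.mul_same, hL, hm.mul_same]
        · rw [isMatrixUnits_munit.mul_ne _ _ _ _ _ _ h, hm.mul_ne _ _ _ _ _ _ h, map_zero]
  exact ⟨AlgHom.ofLinearMap L h1 hmul, hL⟩

end Blocks

section MatrixUnits

variable {I : Type} [Fintype I] {n : I → ℕ} {R : Type v} [Semiring R]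
  {m : ∀ i, Fin (n i) → Fin (n i) → R}

theorem IsMatrixUnits.orthogonal (hm : IsMatrixUnits m) (p q : Σ i, Fin (n i)) (h : p ≠ q) :
    m p.1 p.2 p.2 * m q.1 q.2 q.2 = 0 :=
  hm.mul_ne _ _ _ _ _ _ h

theorem IsMatrixUnits.isComplIdem [DecidableEq I] (hm : IsMatrixUnits m) (i : I) (j : Fin (n i)) :
    IsComplIdem (m i j j) := by
  simpa using isComplIdem_sum (g := fun p : Σ i, Fin (n i) => m p.1 p.2 p.2)
    hm.orthogonal hm.sum_diag {⟨i, j⟩}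

theorem IsMatrixUnits.mvn (hm : IsMatrixUnits m) (i : I) (j k : Fin (n i)) :
    MvN (m i j j) (m i k k) :=
  ⟨m i j k, m i k j, hm.mul_same _ _ _ _, hm.mul_same _ _ _ _⟩

/-- A complete family of orthogonal idempotents which are equivalent within each block extends to a
system of matrix units. -/
theorem exists_matrixUnits [DecidableEq I] (hn : ∀ i, 0 < n i) {g : (Σ i, Fin (n i)) → R}
    (hg : ∀ p q, p ≠ q → g p * g q = 0) (h1 : ∑ p, g p = 1)
    (hE : ∀ i j k, MvN (g ⟨i, j⟩) (g ⟨i, k⟩)) :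
    ∃ m : ∀ i, Fin (n i) → Fin (n i) → R, IsMatrixUnits m ∧ ∀ i j, m i j j = g ⟨i, j⟩ := by
  have hid : ∀ p, g p * g p = g p := fun p => by
    have := (isComplIdem_sum hg h1 {p}).mul_self
    simpa using this
  -- Every idempotent of a block is linked to the one of index `0`; the matrix unit at `(j, k)`
  -- passes from `j` to `k` through it.
  choose x y hxy hyx hx hx' hy hy' using fun i j =>
    (hE i j ⟨0, hn i⟩).exists_corner (hid _) (hid _)
  refine ⟨fun i j k => x i j * y i k, ⟨?_, ?_, ?_⟩, hxy⟩
  · intro i j k l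
    calc x i j * y i k * (x i k * y i l) = x i j * (y i k * x i k) * y i l := by
          simp only [mul_assoc]
      _ = x i j * y i l := by rw [hyx, hx']
  · intro i j k i' j' l h
    calc x i j * y i k * (x i' j' * y i' l)
        = x i j * (y i k * g ⟨i, k⟩) * ((g ⟨i', j'⟩ * x i' j') * y i' l) := by
          rw [hy', hx]
      _ = x i j * y i k * (g ⟨i, k⟩ * g ⟨i', j'⟩) * (x i' j' * y i' l) := by
          simp only [mul_assoc]
      _ = 0 := by rw [hg _ _ h, mul_zero, zero_mul]
  · rw [← h1]
    exact Finset.sum_congr rfl fun p _ => hxy p.1 p.2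

/-- Two systems of matrix units with equivalent diagonal idempotents are conjugate. -/
theorem exists_conj_matrixUnits [DecidableEq I] (hn : ∀ i, 0 < n i) {m' : ∀ i, Fin (n i) → Fin (n i) → R}
    (hm : IsMatrixUnits m) (hm' : IsMatrixUnits m')
    (h : ∀ i j, MvN (m i j j) (m' i j j)) :
    ∃ a : Rˣ, ∀ i j k, (a : R) * m i j k * (↑a⁻¹ : R) = m' i j k := by
  -- The conjugating unit is `∑ m' j 0 * y * m 0 j`, with inverse `∑ m j 0 * x * m' 0 j`, where `x`,
  -- `y` link the two idempotents of index `0` in each block. Stating `key` for arbitrary systems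
  -- yields both products by exchanging their roles.
  have key : ∀ (m m' : ∀ i, Fin (n i) → Fin (n i) → R) (_ : IsMatrixUnits m)
      (_ : IsMatrixUnits m') (s t : I → R), (∀ i, s i * t i = m i ⟨0, hn i⟩ ⟨0, hn i⟩) →
      (∀ i, m' i ⟨0, hn i⟩ ⟨0, hn i⟩ * t i = t i) →
      (∑ p : Σ i, Fin (n i), m p.1 p.2 ⟨0, hn p.1⟩ * s p.1 * m' p.1 ⟨0, hn p.1⟩ p.2) *
      (∑ p : Σ i, Fin (n i), m' p.1 p.2 ⟨0, hn p.1⟩ * t p.1 * m p.1 ⟨0, hn p.1⟩ p.2) = 1 := by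
    intro m m' hm hm' s t hst ht
    rw [Finset.sum_mul_sum, ← hm.sum_diag]
    refine Finset.sum_congr rfl fun p _ => ?_
    rw [Finset.sum_eq_single p]
    · calc m p.1 p.2 ⟨0, hn p.1⟩ * s p.1 * m' p.1 ⟨0, hn p.1⟩ p.2 *
            (m' p.1 p.2 ⟨0, hn p.1⟩ * t p.1 * m p.1 ⟨0, hn p.1⟩ p.2)
          = m p.1 p.2 ⟨0, hn p.1⟩ * (s p.1 * ((m' p.1 ⟨0, hn p.1⟩ p.2 *
            m' p.1 p.2 ⟨0, hn p.1⟩) * t p.1)) * m p.1 ⟨0, hn p.1⟩ p.2 := by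
            simp only [mul_assoc]
        _ = m p.1 p.2 p.2 := by rw [hm'.mul_same, ht, hst, hm.mul_same, hm.mul_same]
    · intro q _ hq
      calc m p.1 p.2 ⟨0, hn p.1⟩ * s p.1 * m' p.1 ⟨0, hn p.1⟩ p.2 *
            (m' q.1 q.2 ⟨0, hn q.1⟩ * t q.1 * m q.1 ⟨0, hn q.1⟩ q.2)
          = m p.1 p.2 ⟨0, hn p.1⟩ * s p.1 * (m' p.1 ⟨0, hn p.1⟩ p.2 *
            m' q.1 q.2 ⟨0, hn q.1⟩) * (t q.1 * m q.1 ⟨0, hn q.1⟩ q.2) := by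
            simp only [mul_assoc]
        _ = 0 := by rw [hm'.mul_ne _ _ _ _ _ _ (Ne.symm hq), mul_zero, zero_mul]
    · simp
  choose x y hxy hyx hx hx' hy hy' using fun i =>
    (h i ⟨0, hn i⟩).exists_corner (hm.isComplIdem _ _).mul_self (hm'.isComplIdem _ _).mul_self
  refine ⟨⟨_, _, key m' m hm' hm y x hyx hx, key m m' hm hm' x y hxy hy⟩, fun i j k => ?_⟩
  rw [Units.mul_inv_eq_iff_eq_mul]
  simp only
  rw [Finset.sum_mul, Finset.mul_sum, Finset.sum_eq_single ⟨i, j⟩, Finset.sum_eq_single ⟨i, k⟩]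
  · calc m' i j ⟨0, hn i⟩ * y i * m i ⟨0, hn i⟩ j * m i j k
        = m' i j ⟨0, hn i⟩ * y i * (m i ⟨0, hn i⟩ j * m i j k) := by simp only [mul_assoc]
      _ = (m' i j k * m' i k ⟨0, hn i⟩) * y i * m i ⟨0, hn i⟩ k := by
        rw [hm.mul_same, hm'.mul_same]
      _ = _ := by simp only [mul_assoc]
  · intro q _ hq
    rw [← mul_assoc, ← mul_assoc, hm'.mul_ne _ _ _ _ _ _ (Ne.symm hq), zero_mul, zero_mul]
  · simp
  · intro q _ hq
    rw [mul_assoc, hm.mul_ne _ _ _ _ _ _ hq, mul_zero]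
  · simp

end MatrixUnits

/-! ### Complemented idempotents of matrix algebras over a semifield -/

/-- Equal rank gives an isomorphism between the ranges; `x` and `y` are this isomorphism and its
inverse, each preceded by the projection onto its source. -/
theorem mvn_of_rank_eq {K : Type u} [Field K] {n : ℕ} {e f : Matrix (Fin n) (Fin n) K}
    (he : e * e = e) (hf : f * f = f) (h : e.rank = f.rank) : MvN e f := by
  let V := Fin n → K
  let E : V →ₗ[K] V := Matrix.toLin' e
  let G : V →ₗ[K] V := Matrix.toLin' f
  have hE : ∀ z ∈ LinearMap.range E, E z = z := by
    rintro _ ⟨z, rfl⟩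
    change (Matrix.toLin' e ∘ₗ Matrix.toLin' e) z = _
    rw [← Matrix.toLin'_mul, he]
  have hG : ∀ z ∈ LinearMap.range G, G z = z := by
    rintro _ ⟨z, rfl⟩
    change (Matrix.toLin' f ∘ₗ Matrix.toLin' f) z = _
    rw [← Matrix.toLin'_mul, hf]
  have hr : Module.finrank K (LinearMap.range E) = Module.finrank K (LinearMap.range G) := h
  let θ : LinearMap.range E ≃ₗ[K] LinearMap.range G := LinearEquiv.ofFinrankEq _ _ hr
  have aux : ∀ (A B : V →ₗ[K] V) (θ : LinearMap.range A ≃ₗ[K] LinearMap.range B)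
      (_ : ∀ z ∈ LinearMap.range B, B z = z),
      LinearMap.comp ((LinearMap.range A).subtype ∘ₗ θ.symm.toLinearMap ∘ₗ B.rangeRestrict)
        ((LinearMap.range B).subtype ∘ₗ θ.toLinearMap ∘ₗ A.rangeRestrict) = A := by
    intro A B θ hB
    refine LinearMap.ext fun z => ?_
    have : B.rangeRestrict (θ (A.rangeRestrict z) : V) = θ (A.rangeRestrict z) := by
      ext1; exact hB _ (θ _).2
    simp only [LinearMap.comp_apply, LinearEquiv.coe_coe, Submodule.subtype_apply, this]
    simp
  refine ⟨LinearMap.toMatrix' ((LinearMap.range E).subtype ∘ₗ θ.symm.toLinearMap ∘ₗ G.rangeRestrict),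
    LinearMap.toMatrix' ((LinearMap.range G).subtype ∘ₗ θ.toLinearMap ∘ₗ E.rangeRestrict), ?_, ?_⟩
  · rw [← LinearMap.toMatrix'_comp, aux E G θ hG, LinearMap.toMatrix'_toLin']
  · rw [← LinearMap.toMatrix'_comp]
    have := aux G E θ.symm hE
    rw [LinearEquiv.symm_symm] at this
    rw [this, LinearMap.toMatrix'_toLin']

theorem exists_mvn_diagonal_of_field {K : Type u} [Field K] {n : ℕ}
    {e : Matrix (Fin n) (Fin n) K} (he : e * e = e) :
    ∃ s : Finset (Fin n), MvN e (∑ j ∈ s, Matrix.single j j 1) := by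
  classical
  have hn : e.rank ≤ (Finset.univ : Finset (Fin n)).card := by simpa using e.rank_le_width
  obtain ⟨s, -, hs⟩ := Finset.exists_subset_card_eq hn
  have hd : ∑ j ∈ s, Matrix.single j j (1 : K) =
      Matrix.diagonal (fun j => if j ∈ s then 1 else 0) := by
    rw [← Matrix.sum_single_eq_diagonal, ← Finset.sum_subset (Finset.subset_univ s)]
    · exact Finset.sum_congr rfl fun j hj => by rw [if_pos hj]
    · intro j _ hj; simp [hj]
  refine ⟨s, mvn_of_rank_eq he ?_ ?_⟩
  · rw [hd, Matrix.diagonal_mul_diagonal]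
    simp
  · rw [hd, Matrix.rank_diagonal, ← hs]
    simp [Fintype.card_subtype]

/-- A semifield in which `-1` exists is a field. -/
@[reducible]
def Semifield.toFieldOfNeg {F : Type u} [h : Semifield F] (a : F) (ha : 1 + a = 0) : Field F :=
  { h with
    neg := fun x => a * x
    zsmul := @zsmulRec F _ _ ⟨fun x => a * x⟩ (· • ·)
    zsmul_zero' := fun x => zero_nsmul x
    zsmul_succ' := fun n x => succ_nsmul x n
    zsmul_neg' := fun n x => rfl
    neg_add_cancel := fun x => by
      have : (1 + a) * x = 0 := by rw [ha, zero_mul]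
      rw [add_mul, one_mul, add_comm] at this
      exact this
    qsmul := _
    qsmul_def := fun _ _ => rfl }

/-- If `-1` exists, `F` is a field and the rank decides. Otherwise `a + b = 0` forces `a = 0`, so `e
+ e' = 1` kills the off-diagonal entries of `e`, and `e * e' = 0` makes each diagonal entry `0` or
`1`: `e` is already diagonal. -/
theorem exists_mvn_diagonal {F : Type u} [Semifield F] {n : ℕ}
    {e : Matrix (Fin n) (Fin n) F} (he : IsComplIdem e) :
    ∃ s : Finset (Fin n), MvN e (∑ j ∈ s, Matrix.single j j 1) := by
  classical
  by_cases h : ∃ a : F, 1 + a = 0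
  · obtain ⟨a, ha⟩ := h
    let _ : Field F := Semifield.toFieldOfNeg a ha
    exact exists_mvn_diagonal_of_field he.mul_self
  · have hz : ∀ a b : F, a + b = 0 → a = 0 := by
      intro a b hab
      by_contra h0
      refine h ⟨a⁻¹ * b, ?_⟩
      rw [← inv_mul_cancel₀ h0, ← mul_add, hab, mul_zero]
    have hid := he.mul_self
    obtain ⟨e', h1, h2, -⟩ := he
    have hoff : ∀ j k, j ≠ k → e j k = 0 := fun j k hjk => by
      have := congrFun (congrFun h1 j) k
      rw [Matrix.add_apply, Matrix.one_apply_ne hjk] at this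
      exact hz _ _ this
    have hdiag : ∀ j, e j j = 0 ∨ e j j = 1 := fun j => by
      have hj := congrFun (congrFun h1 j) j
      have hj2 := congrFun (congrFun h2 j) j
      rw [Matrix.add_apply, Matrix.one_apply_eq] at hj
      rw [Matrix.mul_apply, Finset.sum_eq_single j
        (fun k _ hk => by rw [hoff j k hk.symm, zero_mul]) (by simp), Matrix.zero_apply] at hj2
      rcases mul_eq_zero.1 hj2 with h | h
      · exact Or.inl h
      · rw [h, add_zero] at hj; exact Or.inr hj
    refine ⟨Finset.univ.filter fun j => e j j = 1, ?_⟩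
    have : ∑ j with e j j = 1, Matrix.single j j (1 : F) = e := by
      rw [Finset.sum_filter]
      have : ∀ j, (if e j j = 1 then Matrix.single j j (1 : F) else 0) =
          Matrix.single j j (e j j) := fun j => by
        split_ifs with h
        · rw [h]
        · rw [(hdiag j).resolve_right h, Matrix.single_zero]
      simp only [this]
      rw [Matrix.sum_single_eq_diagonal (fun j => e j j)]
      ext j k
      by_cases hjk : j = k
      · subst hjk; simp
      · rw [Matrix.diagonal_apply_ne _ hjk, hoff j k hjk]
    rw [this]
    exact ⟨e, e, hid, hid⟩

theorem Blocks.exists_mvn_sum_munit {F : Type u} [Semifield F] {I : Type} [Fintype I]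
    [DecidableEq I] {n : I → ℕ} {e : Blocks F n} (he : IsComplIdem e) :
    ∃ s : Finset (Σ i, Fin (n i)), MvN e (∑ p ∈ s, munit F p.1 p.2 p.2) := by
  have hi : ∀ i, IsComplIdem (e i) := fun i =>
    he.map (Pi.evalRingHom (fun i => Matrix (Fin (n i)) (Fin (n i)) F) i)
  choose s x y hxy hyx using fun i => exists_mvn_diagonal (hi i)
  refine ⟨Finset.univ.sigma s, x, y, funext hxy, ?_⟩
  rw [Finset.sum_sigma, ← Finset.univ_sum_single (y * x)]
  refine Finset.sum_congr rfl fun i _ => ?_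
  rw [Pi.mul_apply, hyx]
  simp only [munit, ← LinearMap.coe_single (R := F)
    (φ := fun i => Matrix (Fin (n i)) (Fin (n i)) F), map_sum]

/-! ### Realizing maps of `SV` on matricial algebras -/

/-- `φ : B → T` realizes `f ∘ β_*`, where `β : B → S`. -/
def Realizes {F : Type u} [Semifield F] {B : Type*} [Semiring B] [Algebra F B]
    {S : Type v} [Semiring S] [Algebra F S] {T : Type w} [Semiring T] [Algebra F T]
    (f : SV S ≃+ SV T) (β : B →ₐ[F] S) (φ : B →ₐ[F] T) : Prop :=
  ∀ e : B, IsComplIdem e → f (cls (β e)) = cls (φ e)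

theorem Realizes.symm {F : Type u} [Semifield F] {B : Type*} [Semiring B] [Algebra F B]
    {S : Type v} [Semiring S] [Algebra F S] {T : Type w} [Semiring T] [Algebra F T]
    {f : SV S ≃+ SV T} {β : B →ₐ[F] S} {φ : B →ₐ[F] T} (h : Realizes f β φ) :
    Realizes f.symm φ β := fun e he => by rw [← h e he, AddEquiv.symm_apply_apply]

section

variable {F : Type u} [Semifield F] {I : Type} [Fintype I] [DecidableEq I] {n : I → ℕ}
  {S : Type v} [Semiring S] [Algebra F S] {T : Type w} [Semiring T] [Algebra F T]

/-- Every complemented idempotent is equivalent to a sum of diagonal matrix units, and homomorphisms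
respect equivalence and orthogonal sums. -/
theorem realizes_of_munit {f : SV S ≃+ SV T} {β : Blocks F n →ₐ[F] S} {φ : Blocks F n →ₐ[F] T}
    (h : ∀ i j, f (cls (β (Blocks.munit F i j j))) = cls (φ (Blocks.munit F i j j))) :
    Realizes f β φ := by
  intro e he
  obtain ⟨s, hs⟩ := Blocks.exists_mvn_sum_munit he
  have hu := Blocks.isMatrixUnits_munit (F := F) (n := n)
  have hc : IsComplIdem (∑ p ∈ s, Blocks.munit F p.1 p.2 p.2) :=
    isComplIdem_sum (g := fun p : Σ i, Fin (n i) => Blocks.munit F p.1 p.2 p.2)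
      hu.orthogonal hu.sum_diag s
  rw [(cls_eq_cls_iff (he.map β) (hc.map β)).2 (hs.map β),
    (cls_eq_cls_iff (he.map φ) (hc.map φ)).2 (hs.map φ), map_sum, map_sum,
    cls_sum (g := fun p : Σ i, Fin (n i) => β (Blocks.munit F p.1 p.2 p.2))
      (hu.map β).orthogonal (hu.map β).sum_diag,
    cls_sum (g := fun p : Σ i, Fin (n i) => φ (Blocks.munit F p.1 p.2 p.2))
      (hu.map φ).orthogonal (hu.map φ).sum_diag, map_sum]
  exact Finset.sum_congr rfl fun p _ => h p.1 p.2

/-- Existence: the classes `f [β e_jj]` add up to `[T]`, so they come from a complete orthogonal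
family in `T`. Within a block they coincide, so the family extends to matrix units. -/
theorem exists_realizes (hn : ∀ i, 0 < n i) (f : SV S ≃+ SV T) (hf : f (SV.unit S) = SV.unit T)
    (β : Blocks F n →ₐ[F] S) : ∃ φ : Blocks F n →ₐ[F] T, Realizes f β φ := by
  have hu := (Blocks.isMatrixUnits_munit (F := F) (n := n)).map β
  have hsum : ∑ p : Σ i, Fin (n i), f (cls (β (Blocks.munit F p.1 p.2 p.2))) = SV.unit T := by
    rw [← map_sum, ← cls_sum (g := fun p : Σ i, Fin (n i) => β (Blocks.munit F p.1 p.2 p.2))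
      hu.orthogonal hu.sum_diag, hu.sum_diag, cls_one, hf]
  obtain ⟨g, hg, hg1, hgc⟩ := exists_idempotents_of_sum_eq_unit _ hsum
  have hgi : ∀ p, IsComplIdem (g p) := fun p => by simpa using isComplIdem_sum hg hg1 {p}
  obtain ⟨m, hm, hmd⟩ := exists_matrixUnits hn hg hg1 (fun i j k => by
    rw [← cls_eq_cls_iff (hgi _) (hgi _), hgc, hgc,
      (cls_eq_cls_iff (hu.isComplIdem i j) (hu.isComplIdem i k)).2 (hu.mvn i j k)])
  obtain ⟨φ, hφ⟩ := Blocks.exists_algHom (F := F) hm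
  exact ⟨φ, realizes_of_munit fun i j => by rw [hφ, hmd, hgc]⟩

/-- Conjugation by a unit. -/
def conjHom (F : Type u) [Semifield F] {T : Type w} [Semiring T] [Algebra F T] (a : Tˣ) :
    T →ₐ[F] T where
  toFun x := a * x * (↑a⁻¹ : T)
  map_one' := by simp
  map_mul' x y := by simp [mul_assoc]
  map_zero' := by simp
  map_add' x y := by simp [mul_add, add_mul]
  commutes' r := by simp [← Algebra.commutes, mul_assoc]

theorem mvn_conjHom (a : Tˣ) {e : T} (he : e * e = e) : MvN e (conjHom F a e) := by
  refine ⟨e * (↑a⁻¹ : T), a * e, ?_, ?_⟩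
  · rw [mul_assoc, Units.inv_mul_cancel_left, he]
  · rw [mul_assoc, ← mul_assoc e, he, ← mul_assoc]; rfl

theorem Realizes.conj {B : Type*} [Semiring B] [Algebra F B] {f : SV S ≃+ SV T}
    {β : B →ₐ[F] S} {φ : B →ₐ[F] T} (h : Realizes f β φ) (a : Tˣ) :
    Realizes f β ((conjHom F a).comp φ) := by
  intro e he
  rw [h e he, cls_eq_cls_iff (he.map φ) (he.map _)]
  exact mvn_conjHom (F := F) a (he.map φ).mul_self

/-- Uniqueness: equal classes make the diagonals of the two image systems equivalent, hence the
systems conjugate. -/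
theorem exists_conj_of_cls_eq (hn : ∀ i, 0 < n i) {φ ψ : Blocks F n →ₐ[F] T}
    (h : ∀ e, IsComplIdem e → cls (φ e) = cls (ψ e)) :
    ∃ a : Tˣ, (conjHom F a).comp φ = ψ := by
  have hu := Blocks.isMatrixUnits_munit (F := F) (n := n)
  obtain ⟨a, ha⟩ := exists_conj_matrixUnits hn (hu.map φ) (hu.map ψ) (fun i j =>
    (cls_eq_cls_iff ((hu.isComplIdem i j).map φ) ((hu.isComplIdem i j).map ψ)).1
      (h _ (hu.isComplIdem i j)))
  exact ⟨a, Blocks.algHom_ext ha⟩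

end

/-! ### Presentations of ultramatricial algebras -/

/-- A presentation of `A` as the direct limit of a sequence of products of matrix algebras. -/
structure Presentation (F : Type u) [Semifield F] (A : Type v) [Semiring A] [Algebra F A] where
  r : ℕ → ℕ
  n : ∀ k, Fin (r k) → ℕ
  pos : ∀ k i, 0 < n k i
  map : ∀ i j, i ≤ j → Blocks F (n i) →ₐ[F] Blocks F (n j)
  ι : ∀ i, Blocks F (n i) →ₐ[F] A
  map_self : ∀ i x, map i i le_rfl x = x
  map_map : ∀ i j k hij hjk x, map j k hjk (map i j hij x) = map i k (hij.trans hjk) x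
  ι_map : ∀ i j h x, ι j (map i j h x) = ι i x
  surj : ∀ a, ∃ i x, ι i x = a
  inj : ∀ i x y, ι i x = ι i y → ∃ j h, map i j h x = map i j h y

theorem IsUltramatricial.nonempty_presentation {F : Type u} [Semifield F] {A : Type v}
    [Semiring A] [Algebra F A] (h : IsUltramatricial F A) : Nonempty (Presentation F A) := by
  obtain ⟨B, _, _, f, _, hB, ⟨e⟩⟩ := h
  choose r n hn E using hB
  let E := fun i => (E i).some
  let ι : ∀ i, B i →ₐ[F] DirectLimit B f := fun i =>
    { toFun := fun x => ⟦⟨i, x⟩⟧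
      map_one' := (DirectLimit.one_def i).symm
      map_mul' := fun x y => (DirectLimit.mul_def i x y).symm
      map_zero' := (DirectLimit.zero_def i).symm
      map_add' := fun x y => (DirectLimit.add_def i x y).symm
      commutes' := fun c => by
        rw [Algebra.algebraMap_eq_smul_one, Algebra.algebraMap_eq_smul_one,
          DirectLimit.one_def i, DirectLimit.smul_def] }
  have hι : ∀ i j h x, ι j (f i j h x) = ι i x := fun i j h x =>
    DirectLimit.mk_apply (f := f) i j x h
  refine ⟨⟨r, n, hn, fun i j h => ((E j).toAlgHom.comp (f i j h)).comp (E i).symm.toAlgHom,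
    fun i => (e.symm.toAlgHom.comp (ι i)).comp (E i).symm.toAlgHom, ?_, ?_, ?_, ?_, ?_⟩⟩
  · intro i x
    simp [DirectedSystem.map_self' (f := f)]
  · intro i j k hij hjk x
    simp [DirectedSystem.map_map' (f := f)]
  · intro i j h x
    simp [hι]
  · intro a
    obtain ⟨i, x, hx⟩ := DirectLimit.exists_eq_mk f (e a)
    refine ⟨i, E i x, ?_⟩
    change e.symm (ι i ((E i).symm (E i x))) = a
    rw [AlgEquiv.symm_apply_apply]
    exact e.symm_apply_eq.2 hx.symm
  · intro i x y hxy
    have : ι i ((E i).symm x) = ι i ((E i).symm y) := e.symm.injective hxy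
    obtain ⟨j, h, h', hj⟩ := Quotient.exact this
    exact ⟨j, h, congrArg (E j) hj⟩

namespace Presentation

variable {F : Type u} [Semifield F] {T : Type w} [Semiring T] [Algebra F T]
  (P : Presentation F T)

/-- The equalities hold at every stage beyond `N`, so that several such bounds can be met at once.
-/
theorem exists_map_eq {K : Type*} [Finite K] {i : ℕ} (x y : K → Blocks F (P.n i))
    (h : ∀ k, P.ι i (x k) = P.ι i (y k)) :
    ∃ N, ∀ j (hij : i ≤ j), N ≤ j → ∀ k, P.map i j hij (x k) = P.map i j hij (y k) := by
  classical
  have := Fintype.ofFinite K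
  choose N hN hxy using fun k => P.inj i _ _ (h k)
  refine ⟨∑ k, N k, fun j hij hj k => ?_⟩
  have hk : N k ≤ j := (Finset.single_le_sum (fun _ _ => Nat.zero_le _) (Finset.mem_univ k)).trans hj
  rw [← P.map_map i (N k) j (hN k) hk, hxy, P.map_map]

theorem exists_lift {K : Type*} [Finite K] (x : K → T) :
    ∃ i, ∃ y : K → Blocks F (P.n i), ∀ k, P.ι i (y k) = x k := by
  classical
  have := Fintype.ofFinite K
  choose i y hy using fun k => P.surj (x k)
  have hle : ∀ k, i k ≤ ∑ k, i k := fun k =>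
    Finset.single_le_sum (fun _ _ => Nat.zero_le _) (Finset.mem_univ k)
  exact ⟨∑ k, i k, fun k => P.map _ _ (hle k) (y k), fun k => by rw [P.ι_map, hy]⟩

variable {I : Type} [Fintype I] [DecidableEq I] {n : I → ℕ}

/-- Homomorphisms from a product of matrix algebras that agree in the limit agree at some finite
stage. -/
theorem exists_comp_eq {i : ℕ} (a b : Blocks F n →ₐ[F] Blocks F (P.n i))
    (h : (P.ι i).comp a = (P.ι i).comp b) :
    ∃ N, ∀ j (hij : i ≤ j), N ≤ j → (P.map i j hij).comp a = (P.map i j hij).comp b := by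
  obtain ⟨N, hN⟩ := P.exists_map_eq
    (K := Σ i, Fin (n i) × Fin (n i))
    (fun p => a (Blocks.munit F p.1 p.2.1 p.2.2)) (fun p => b (Blocks.munit F p.1 p.2.1 p.2.2))
    (fun p => DFunLike.congr_fun h _)
  exact ⟨N, fun j hij hj => Blocks.algHom_ext fun i j k => hN _ hij hj ⟨i, j, k⟩⟩

/-- A homomorphism from a product of matrix algebras to a limit factors through a finite stage. -/
theorem exists_factor (φ : Blocks F n →ₐ[F] T) :
    ∃ i, ∃ a : Blocks F n →ₐ[F] Blocks F (P.n i), (P.ι i).comp a = φ := by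
  have hu := (Blocks.isMatrixUnits_munit (F := F) (n := n)).map φ
  obtain ⟨i, y, hy⟩ := P.exists_lift
    (fun p : Σ i, Fin (n i) × Fin (n i) => φ (Blocks.munit F p.1 p.2.1 p.2.2))
  let m : ∀ i', Fin (n i') → Fin (n i') → Blocks F (P.n i) := fun i j k => y ⟨i, j, k⟩
  have hm : ∀ i' j k, P.ι i (m i' j k) = φ (Blocks.munit F i' j k) := fun i' j k => hy ⟨i', j, k⟩
  -- The lifts satisfy the matrix unit relations only in the limit; there are finitely many
  -- relations, so all hold at a later stage.
  obtain ⟨N₁, h₁⟩ := P.exists_map_eq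
    (K := Σ i, Fin (n i) × Fin (n i) × Fin (n i))
    (fun p => m p.1 p.2.1 p.2.2.1 * m p.1 p.2.2.1 p.2.2.2) (fun p => m p.1 p.2.1 p.2.2.2)
    (fun p => by rw [map_mul, hm, hm, hm, hu.mul_same])
  obtain ⟨N₂, h₂⟩ := P.exists_map_eq
    (K := {q : (Σ i, Fin (n i) × Fin (n i)) × (Σ i, Fin (n i) × Fin (n i)) //
      (⟨q.1.1, q.1.2.2⟩ : Σ i, Fin (n i)) ≠ ⟨q.2.1, q.2.2.1⟩})
    (fun q => m q.1.1.1 q.1.1.2.1 q.1.1.2.2 * m q.1.2.1 q.1.2.2.1 q.1.2.2.2) (fun _ => 0)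
    (fun q => by rw [map_mul, hm, hm, hu.mul_ne _ _ _ _ _ _ q.2, map_zero])
  obtain ⟨N₃, h₃⟩ := P.exists_map_eq (K := Unit)
    (fun _ => ∑ p : Σ i, Fin (n i), m p.1 p.2 p.2) (fun _ => 1)
    (fun _ => by rw [map_sum, map_one, ← hu.sum_diag]; simp only [hm])
  let j := i + N₁ + N₂ + N₃
  have hij : i ≤ j := by omega
  have hmu : IsMatrixUnits fun i' k l => P.map i j hij (m i' k l) :=
    { mul_same := fun i' k l l' => by
        rw [← map_mul]; exact h₁ j hij (by omega) ⟨i', k, l, l'⟩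
      mul_ne := fun i' k l i'' k' l' h => by
        rw [← map_mul, h₂ j hij (by omega) ⟨⟨⟨i', k, l⟩, ⟨i'', k', l'⟩⟩, h⟩, map_zero]
      sum_diag := by rw [← map_sum, h₃ j hij (by omega) (), map_one] }
  obtain ⟨a, ha⟩ := Blocks.exists_algHom (F := F) hmu
  exact ⟨j, a, Blocks.algHom_ext fun i' k l => by rw [AlgHom.comp_apply, ha, P.ι_map, hm]⟩

/-- After factoring `φ`, its composite with `a₀` and the connecting map agree in the limit, hence at
a later stage, which may also be taken beyond `k`. -/
theorem exists_factor_of_comp_eq (φ : Blocks F n →ₐ[F] T) {m₀ : ℕ}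
    (a₀ : Blocks F (P.n m₀) →ₐ[F] Blocks F n) (h : φ.comp a₀ = P.ι m₀) (k : ℕ) :
    ∃ m, ∃ hm : m₀ ≤ m, k ≤ m ∧ ∃ a : Blocks F n →ₐ[F] Blocks F (P.n m),
      (P.ι m).comp a = φ ∧ a.comp a₀ = P.map m₀ m hm := by
  obtain ⟨i, a, ha⟩ := P.exists_factor φ
  have hcomp : ∀ j (hij : i ≤ j), (P.ι j).comp (P.map i j hij) = P.ι i := fun j hij =>
    AlgHom.ext fun x => P.ι_map _ _ _ _
  let j := i + m₀
  have hi : i ≤ j := by omega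
  have hm₀ : m₀ ≤ j := by omega
  obtain ⟨N, hN⟩ := P.exists_comp_eq (i := j) (((P.map i j hi).comp a).comp a₀)
    (P.map m₀ j hm₀) (by
      ext x
      have h1 := DFunLike.congr_fun h x
      have h2 := DFunLike.congr_fun ha (a₀ x)
      simp only [AlgHom.comp_apply] at h1 h2 ⊢
      rw [P.ι_map, P.ι_map, h2, h1])
  let m := j + N + k
  have hjm : j ≤ m := by omega
  refine ⟨m, hm₀.trans hjm, by omega, (P.map i m (hi.trans hjm)).comp a, ?_, ?_⟩
  · rw [← AlgHom.comp_assoc, hcomp, ha]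
  · ext1 x
    have := DFunLike.congr_fun (hN m hjm (by omega)) x
    simp only [AlgHom.comp_apply, P.map_map] at this ⊢
    exact this

end Presentation

/-! ### Intertwining -/

namespace Presentation

variable {F : Type u} [Semifield F] {S : Type v} [Semiring S] [Algebra F S]
  {T : Type w} [Semiring T] [Algebra F T]

/-- Two ultramatricial algebras whose presentations are intertwined are isomorphic. -/
theorem nonempty_algEquiv_of_intertwining (P : Presentation F S) (Q : Presentation F T)
    (n m : ℕ → ℕ) (hn : Monotone n) (hm : Monotone m) (hn' : ∀ k, k ≤ n k) (hm' : ∀ k, k ≤ m k)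
    (a : ∀ k, Blocks F (P.n (n k)) →ₐ[F] Blocks F (Q.n (m k)))
    (b : ∀ k, Blocks F (Q.n (m k)) →ₐ[F] Blocks F (P.n (n (k + 1))))
    (hba : ∀ k x, b k (a k x) = P.map _ _ (hn k.le_succ) x)
    (hab : ∀ k y, a (k + 1) (b k y) = Q.map _ _ (hm k.le_succ) y) :
    Nonempty (S ≃ₐ[F] T) := by
  have ha : ∀ k l (h : k ≤ l) x, a l (P.map _ _ (hn h) x) = Q.map _ _ (hm h) (a k x) := by
    intro k l h x
    induction l, h using Nat.le_induction with
    | base => rw [P.map_self, Q.map_self]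
    | succ l h ih =>
      rw [← P.map_map _ _ _ (hn h) (hn l.le_succ), ← hba, hab, ih, Q.map_map]
  -- The isomorphism is built as a relation: once it is total and single-valued, each homomorphism
  -- law follows by exhibiting one common stage.
  let rel : S → T → Prop := fun s t => ∃ k x, P.ι (n k) x = s ∧ Q.ι (m k) (a k x) = t
  have lift : ∀ {s t}, rel s t → ∃ k, ∀ l, k ≤ l → ∃ x, P.ι (n l) x = s ∧ Q.ι (m l) (a l x) = t := by
    rintro s t ⟨k, x, rfl, rfl⟩
    exact ⟨k, fun l h => ⟨P.map _ _ (hn h) x, P.ι_map _ _ _ _, by rw [ha k l h, Q.ι_map]⟩⟩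
  have lift₂ : ∀ {s t s' t'}, rel s t → rel s' t' → ∃ k x y,
      (P.ι (n k) x = s ∧ Q.ι (m k) (a k x) = t) ∧ P.ι (n k) y = s' ∧ Q.ι (m k) (a k y) = t' := by
    intro s t s' t' h h'
    obtain ⟨k, hk⟩ := lift h
    obtain ⟨l, hl⟩ := lift h'
    obtain ⟨x, hx⟩ := hk (k + l) (by omega)
    obtain ⟨y, hy⟩ := hl (k + l) (by omega)
    exact ⟨_, x, y, hx, hy⟩
  have total : ∀ s, ∃ t, rel s t := by
    intro s
    obtain ⟨i, x, rfl⟩ := P.surj s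
    exact ⟨_, i, P.map _ _ (hn' i) x, P.ι_map _ _ _ _, rfl⟩
  have total' : ∀ t, ∃ s, rel s t := by
    intro t
    obtain ⟨i, y, rfl⟩ := Q.surj t
    exact ⟨_, i + 1, b i (Q.map _ _ (hm' i) y), rfl, by rw [hab, Q.ι_map, Q.ι_map]⟩
  have unique : ∀ {s t t'}, rel s t → rel s t' → t = t' := by
    intro s t t' h h'
    obtain ⟨k, x, y, ⟨h1, rfl⟩, h2, rfl⟩ := lift₂ h h'
    obtain ⟨N, hN, hxy⟩ := P.inj _ x y (h1.trans h2.symm)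
    have hl : k ≤ k + N := by omega
    have hNl : N ≤ n (k + N) := (Nat.le_add_left N k).trans (hn' _)
    rw [← Q.ι_map _ _ (hm hl), ← ha k _ hl, ← Q.ι_map _ _ (hm hl) (a k y), ← ha k _ hl,
      ← P.map_map _ _ _ hN hNl, hxy, P.map_map]
  have unique' : ∀ {s s' t}, rel s t → rel s' t → s = s' := by
    intro s s' t h h'
    obtain ⟨k, x, y, ⟨rfl, h1⟩, rfl, h2⟩ := lift₂ h h'
    obtain ⟨N, hN, hxy⟩ := Q.inj _ (a k x) (a k y) (h1.trans h2.symm)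
    have hl : k ≤ k + N := by omega
    have hNl : N ≤ m (k + N) := (Nat.le_add_left N k).trans (hm' _)
    -- Mapping back by `b` recovers the element of `S` from its image in a late stage of `T`.
    have key : ∀ z, P.ι (n (k + N + 1)) (b (k + N) (Q.map _ _ hNl (Q.map _ _ hN (a k z)))) =
        P.ι (n k) z := by
      intro z
      rw [Q.map_map, ← ha k (k + N) hl, hba, P.ι_map, P.ι_map]
    rw [← key x, hxy, key]
  choose φ hφ using total
  let Φ : S →ₐ[F] T :=
    { toFun := φ
      map_one' := unique (hφ 1) ⟨0, 1, by simp, by simp⟩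
      map_zero' := unique (hφ 0) ⟨0, 0, by simp, by simp⟩
      map_mul' := fun s s' => by
        obtain ⟨k, x, y, ⟨h1, h2⟩, h3, h4⟩ := lift₂ (hφ s) (hφ s')
        exact unique (hφ _) ⟨k, x * y, by rw [map_mul, h1, h3], by rw [map_mul, map_mul, h2, h4]⟩
      map_add' := fun s s' => by
        obtain ⟨k, x, y, ⟨h1, h2⟩, h3, h4⟩ := lift₂ (hφ s) (hφ s')
        exact unique (hφ _) ⟨k, x + y, by rw [map_add, h1, h3], by rw [map_add, map_add, h2, h4]⟩
      commutes' := fun c =>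
        unique (hφ _) ⟨0, algebraMap F _ c, AlgHom.commutes _ _, by
          rw [AlgHom.commutes, AlgHom.commutes]⟩ }
  refine ⟨AlgEquiv.ofBijective Φ ⟨fun s s' h => unique' (hφ s) ?_, fun t => ?_⟩⟩
  · have : φ s = φ s' := h
    rw [this]
    exact hφ s'
  · obtain ⟨s, hs⟩ := total' t
    exact ⟨s, unique (hφ s) hs⟩

/-! ### The back-and-forth construction -/

/-- A lift `ψ` of `f⁻¹` makes the triangle with `a` and `β` commute only on classes; a conjugation,
which does not change classes, makes it commute exactly. -/
theorem _root_.exists_realizes_comp {I J : Type} [Fintype I] [DecidableEq I] [Fintype J]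
    [DecidableEq J] {n : I → ℕ} {n' : J → ℕ} (hn : ∀ i, 0 < n i) (hn' : ∀ j, 0 < n' j)
    {f : SV S ≃+ SV T} (hf : f (SV.unit S) = SV.unit T) {β : Blocks F n →ₐ[F] S}
    {γ : Blocks F n' →ₐ[F] T} (a : Blocks F n →ₐ[F] Blocks F n')
    (h : Realizes f β (γ.comp a)) :
    ∃ ψ : Blocks F n' →ₐ[F] S, ψ.comp a = β ∧ Realizes f ψ γ := by
  obtain ⟨ψ, hψ⟩ := exists_realizes hn' f.symm (by rw [← hf, AddEquiv.symm_apply_apply]) γ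
  obtain ⟨c, hc⟩ := exists_conj_of_cls_eq hn (φ := ψ.comp a) (ψ := β) (fun e he => by
    rw [AlgHom.comp_apply, ← hψ _ (he.map a), ← AlgHom.comp_apply, ← h e he,
      AddEquiv.symm_apply_apply])
  exact ⟨(conjHom F c).comp ψ, by rw [AlgHom.comp_assoc, hc], (hψ.conj c).symm⟩

/-- A homomorphism `a` between finite stages of `S` and `T` together with a homomorphism `ψ` back
into `S` that extends the canonical one along `a` and realizes the inverse of `f`. -/
structure Stage (P : Presentation F S) (Q : Presentation F T) (f : SV S ≃+ SV T) where
  n : ℕ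
  m : ℕ
  a : Blocks F (P.n n) →ₐ[F] Blocks F (Q.n m)
  ψ : Blocks F (Q.n m) →ₐ[F] S
  ψ_comp : ψ.comp a = P.ι n
  realizes : Realizes f ψ (Q.ι m)

/-- Half a step of the back-and-forth. The conclusion has the shape of the hypotheses with `S`, `T`
exchanged and `f` inverted, so two applications lead from one `Stage` to the next. -/
theorem exists_extension {P : Presentation F S} {Q : Presentation F T} {f : SV S ≃+ SV T}
    (hf : f (SV.unit S) = SV.unit T) {n m : ℕ} (a : Blocks F (P.n n) →ₐ[F] Blocks F (Q.n m))
    (ψ : Blocks F (Q.n m) →ₐ[F] S) (hψ : ψ.comp a = P.ι n) (hr : Realizes f ψ (Q.ι m)) (k : ℕ) :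
    ∃ n', ∃ h : n ≤ n', k ≤ n' ∧ ∃ (b : Blocks F (Q.n m) →ₐ[F] Blocks F (P.n n'))
      (φ : Blocks F (P.n n') →ₐ[F] T), (∀ x, b (a x) = P.map _ _ h x) ∧ φ.comp b = Q.ι m ∧
        Realizes f.symm φ (P.ι n') := by
  obtain ⟨n', h, hk, b, hb, hba⟩ := P.exists_factor_of_comp_eq ψ a hψ k
  obtain ⟨φ, h1, h2⟩ := exists_realizes_comp (Q.pos m) (P.pos n') (f := f.symm)
    (by rw [← hf, AddEquiv.symm_apply_apply]) (β := Q.ι m) (γ := P.ι n') b (hb.symm ▸ hr.symm)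
  exact ⟨n', h, hk, b, φ, fun x => DFunLike.congr_fun hba x, h1, h2⟩

theorem Stage.exists_next {P : Presentation F S} {Q : Presentation F T} {f : SV S ≃+ SV T}
    (hf : f (SV.unit S) = SV.unit T) (k : ℕ) (s : Stage P Q f) :
    ∃ (t : Stage P Q f) (hn : s.n ≤ t.n) (hm : s.m ≤ t.m), k ≤ t.n ∧ k ≤ t.m ∧
      ∃ b : Blocks F (Q.n s.m) →ₐ[F] Blocks F (P.n t.n),
        (∀ x, b (s.a x) = P.map _ _ hn x) ∧ ∀ y, t.a (b y) = Q.map _ _ hm y := by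
  obtain ⟨n', hn, hk, b, φ, hba, hφ, hr⟩ := exists_extension hf s.a s.ψ s.ψ_comp s.realizes k
  obtain ⟨m', hm, hk', a', ψ', hab, hψ', hr'⟩ := exists_extension (f := f.symm)
    (by rw [← hf, AddEquiv.symm_apply_apply]) b φ hφ hr k
  exact ⟨⟨n', m', a', ψ', hψ', hr'⟩, hn, hm, hk, hk', b, hba, hab⟩

theorem nonempty_stage (P : Presentation F S) (Q : Presentation F T) (f : SV S ≃+ SV T)
    (hf : f (SV.unit S) = SV.unit T) : Nonempty (Stage P Q f) := by
  obtain ⟨φ, hφ⟩ := exists_realizes (P.pos 0) f hf (P.ι 0)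
  obtain ⟨m, a, rfl⟩ := Q.exists_factor φ
  obtain ⟨ψ, h1, h2⟩ := exists_realizes_comp (P.pos 0) (Q.pos m) hf a hφ
  exact ⟨⟨0, m, a, ψ, h1, h2⟩⟩

theorem nonempty_algEquiv_of_SV_equiv (P : Presentation F S) (Q : Presentation F T)
    (f : SV S ≃+ SV T) (hf : f (SV.unit S) = SV.unit T) : Nonempty (S ≃ₐ[F] T) := by
  obtain ⟨s₀⟩ := nonempty_stage P Q f hf
  choose next hn hm hkn hkm b hba hab using Stage.exists_next (P := P) (Q := Q) hf
  -- Stage `k + 1` is taken beyond index `k + 1` on both sides, which makes the chosen subsequences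
  -- cofinal.
  let s : ℕ → Stage P Q f := fun k => Nat.rec s₀ (fun k t => next (k + 1) t) k
  refine nonempty_algEquiv_of_intertwining P Q (fun k => (s k).n) (fun k => (s k).m)
    (monotone_nat_of_le_succ fun k => hn (k + 1) (s k))
    (monotone_nat_of_le_succ fun k => hm (k + 1) (s k)) ?_ ?_ (fun k => (s k).a)
    (fun k => b (k + 1) (s k)) (fun k => hba (k + 1) (s k)) (fun k => hab (k + 1) (s k))
  · rintro (_ | k)
    · exact Nat.zero_le _
    · exact hkn (k + 1) (s k)
  · rintro (_ | k)
    · exact Nat.zero_le _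
    · exact hkm (k + 1) (s k)

end Presentation

/-! ### Transport of `SV` along an isomorphism of semirings -/

section Transport

variable {S : Type v} [Semiring S] {T : Type w} [Semiring T]

/-- The right semimodules `P` over `S` and `P'` over `T` are isomorphic along `σ : S ≃+* T`. -/
def IsoAlong (σ : S ≃+* T) (P : Type v) [AddCommMonoid P] [Module Sᵐᵒᵖ P] (P' : Type w)
    [AddCommMonoid P'] [Module Tᵐᵒᵖ P'] : Prop :=
  ∃ h : P ≃+ P', ∀ (s : S) (p : P), h (MulOpposite.op s • p) = MulOpposite.op (σ s) • h p

theorem IsoAlong.symm {σ : S ≃+* T} {P : Type v} [AddCommMonoid P] [Module Sᵐᵒᵖ P] {P' : Type w}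
    [AddCommMonoid P'] [Module Tᵐᵒᵖ P'] (h : IsoAlong σ P P') : IsoAlong σ.symm P' P := by
  obtain ⟨h, hh⟩ := h
  refine ⟨h.symm, fun t p => ?_⟩
  rw [AddEquiv.symm_apply_eq, hh, RingEquiv.apply_symm_apply, AddEquiv.apply_symm_apply]

theorem IsoAlong.nonempty_equiv {σ : S ≃+* T} {P Q : Type v} [AddCommMonoid P] [Module Sᵐᵒᵖ P]
    [AddCommMonoid Q] [Module Sᵐᵒᵖ Q] {P' Q' : Type w} [AddCommMonoid P'] [Module Tᵐᵒᵖ P']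
    [AddCommMonoid Q'] [Module Tᵐᵒᵖ Q'] (hP : IsoAlong σ P P') (hQ : IsoAlong σ Q Q')
    (e : P ≃ₗ[Sᵐᵒᵖ] Q) : Nonempty (P' ≃ₗ[Tᵐᵒᵖ] Q') := by
  obtain ⟨h, hh⟩ := hP.symm
  obtain ⟨g, hg⟩ := hQ
  refine ⟨{ (h.trans e.toAddEquiv).trans g with
    map_smul' := fun c p => ?_ }⟩
  change g (e (h (MulOpposite.op c.unop • p))) = c • g (e (h p))
  rw [hh, map_smul, hg, RingEquiv.apply_symm_apply]
  rfl

/-- The range of an additive map that is semilinear along `σ`. -/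
def rangeAlong (σ : S ≃+* T) {P : Type v} [AddCommMonoid P] [Module Sᵐᵒᵖ P] {M : Type w}
    [AddCommMonoid M] [Module Tᵐᵒᵖ M] (j : P →+ M)
    (hj : ∀ (s : S) (p : P), j (MulOpposite.op s • p) = MulOpposite.op (σ s) • j p) :
    Submodule Tᵐᵒᵖ M where
  toAddSubmonoid := AddMonoidHom.mrange j
  smul_mem' := by
    rintro c _ ⟨p, rfl⟩
    exact ⟨MulOpposite.op (σ.symm c.unop) • p, by rw [hj, RingEquiv.apply_symm_apply]; rfl⟩

theorem isoAlong_rangeAlong (σ : S ≃+* T) {P : Type v} [AddCommMonoid P] [Module Sᵐᵒᵖ P]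
    {M : Type w} [AddCommMonoid M] [Module Tᵐᵒᵖ M] (j : P →+ M)
    (hj : ∀ (s : S) (p : P), j (MulOpposite.op s • p) = MulOpposite.op (σ s) • j p)
    (hinj : Function.Injective j) : IsoAlong σ P (rangeAlong σ j hj) := by
  refine ⟨AddEquiv.ofBijective j.mrangeRestrict
    ⟨fun a b h => hinj (congrArg Subtype.val h), j.mrangeRestrict_surjective⟩, fun s p => ?_⟩
  ext1
  exact hj s p

/-- `S` and `T` may live in different universes, so `P` cannot simply be given a `T`-action; a copy
of it is cut out inside `Fin n → T`. -/
theorem exists_isoAlong (σ : S ≃+* T) (P : FGStronglyProjective S) :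
    ∃ P' : FGStronglyProjective T, IsoAlong σ P.carrier P'.carrier := by
  obtain ⟨n, Q, _, _, ⟨e⟩⟩ := P.stronglyProjective
  let E : (P.carrier × Q) ≃+ (Fin n → T) :=
    e.toAddEquiv.trans (AddEquiv.piCongrRight fun _ => σ.toAddEquiv)
  have hE : ∀ (s : S) x, E (MulOpposite.op s • x) = MulOpposite.op (σ s) • E x := by
    intro s x
    ext i
    change σ (e (MulOpposite.op s • x) i) = σ (e x i) * σ s
    rw [map_smul, ← map_mul]
    rfl
  let j : P.carrier →+ (Fin n → T) := E.toAddMonoidHom.comp (AddMonoidHom.inl _ _)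
  let k : Q →+ (Fin n → T) := E.toAddMonoidHom.comp (AddMonoidHom.inr _ _)
  have hj : ∀ (s : S) p, j (MulOpposite.op s • p) = MulOpposite.op (σ s) • j p := fun s p => by
    change E _ = _ • E _
    rw [← hE]
    simp
  have hk : ∀ (s : S) p, k (MulOpposite.op s • p) = MulOpposite.op (σ s) • k p := fun s p => by
    change E _ = _ • E _
    rw [← hE]
    simp
  have hjk : ∀ p q, j p + k q = E (p, q) := fun p q => by
    change E _ + E _ = _
    rw [← map_add]
    simp
  have hjinj : Function.Injective j := fun a b h => congrArg Prod.fst (E.injective h)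
  refine ⟨⟨rangeAlong σ j hj, n, rangeAlong σ k hk, inferInstance, inferInstance,
    ⟨LinearEquiv.ofBijective
      ((rangeAlong σ j hj).subtype.coprod (rangeAlong σ k hk).subtype) ⟨?_, ?_⟩⟩⟩,
    isoAlong_rangeAlong σ j hj hjinj⟩
  · rintro ⟨⟨_, p, rfl⟩, ⟨_, q, rfl⟩⟩ ⟨⟨_, p', rfl⟩, ⟨_, q', rfl⟩⟩ h
    have h' : j p + k q = j p' + k q' := by simpa using h
    rw [hjk, hjk] at h'
    cases E.injective h'
    rfl
  · intro z
    refine ⟨(⟨j (E.symm z).1, _, rfl⟩, ⟨k (E.symm z).2, _, rfl⟩), ?_⟩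
    change j _ + k _ = z
    rw [hjk]
    exact E.apply_symm_apply z

theorem IsoAlong.prod {σ : S ≃+* T} {P Q : Type v} [AddCommMonoid P] [Module Sᵐᵒᵖ P]
    [AddCommMonoid Q] [Module Sᵐᵒᵖ Q] {P' Q' : Type w} [AddCommMonoid P'] [Module Tᵐᵒᵖ P']
    [AddCommMonoid Q'] [Module Tᵐᵒᵖ Q'] (hP : IsoAlong σ P P') (hQ : IsoAlong σ Q Q') :
    IsoAlong σ (P × Q) (P' × Q') := by
  obtain ⟨h, hh⟩ := hP
  obtain ⟨g, hg⟩ := hQ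
  exact ⟨h.prodCongr g, fun s p => Prod.ext (hh s p.1) (hg s p.2)⟩

/-- An isomorphism of semirings induces an isomorphism of the monoids `SV` with their units. -/
theorem exists_SV_equiv (σ : S ≃+* T) : ∃ f : SV S ≃+ SV T, f (SV.unit S) = SV.unit T := by
  choose G hG using exists_isoAlong σ
  let f : SV S → SV T := Quotient.map G fun P Q ⟨e⟩ => (hG P).nonempty_equiv (hG Q) e
  have hf : ∀ (P : FGStronglyProjective S) (P' : FGStronglyProjective T),
      IsoAlong σ P.carrier P'.carrier → f (Quotient.mk _ P) = Quotient.mk _ P' := fun P P' h =>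
    Quotient.sound ((hG P).nonempty_equiv h (LinearEquiv.refl _ _))
  have hadd : ∀ p q, f (p + q) = f p + f q := by
    rintro ⟨P⟩ ⟨Q⟩
    exact hf _ _ ((hG P).prod (hG Q))
  have hbij : Function.Bijective f := by
    constructor
    · rintro ⟨P⟩ ⟨Q⟩ h
      obtain ⟨e⟩ := Quotient.exact h
      exact Quotient.sound ((hG P).symm.nonempty_equiv (hG Q).symm e)
    · rintro ⟨P'⟩
      obtain ⟨P, hP⟩ := exists_isoAlong σ.symm P'
      exact ⟨Quotient.mk _ P, hf _ _ (σ.symm_symm ▸ hP.symm)⟩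
  refine ⟨{ Equiv.ofBijective f hbij with map_add' := hadd }, ?_⟩
  exact hf ⟨S, IsFGStronglyProjective.self S⟩ ⟨T, IsFGStronglyProjective.self T⟩
    ⟨σ.toAddEquiv, fun s p => map_mul σ p s⟩

end Transport

/-! ### The classification theorem -/

theorem theorem5p10 {F : Type u} [Semifield F]
    {S : Type v} [Semiring S] [Algebra F S] {T : Type w} [Semiring T] [Algebra F T]
    (hS : IsUltramatricial F S) (hT : IsUltramatricial F T) :
    (∃ f : SV S ≃+ SV T, f (SV.unit S) = SV.unit T) ↔ Nonempty (S ≃ₐ[F] T) := by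
  obtain ⟨P⟩ := hS.nonempty_presentation
  obtain ⟨Q⟩ := hT.nonempty_presentation
  constructor
  · rintro ⟨f, hf⟩
    exact P.nonempty_algEquiv_of_SV_equiv Q f hf
  · rintro ⟨e⟩
    exact exists_SV_equiv e.toRingEquiv
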